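/- Let $1\le k\le n$ and $r:=\binom nk$. Consider the system $\dot x(t)=f(t,x(t))$, $t\ge 0$, with $f:[0,\infty)\times\mathbb{R}^n\to\mathbb{R}^n$ continuously differentiable with respect to its second variable, i.e. the Jacobian $J(t,x)=\frac{\partial f}{\partial x}(t,x)$ exists and is continuous in $(t,x)\in[0,\infty)\times\mathbb{R}^n$. Let $\Omega\subseteq\mathbb{R}^n$ be closed and convex, and suppose that for every $a\in\Omega$ the system has a unique solution $x(t,a)$, $t\ge0$, with $x(0,a)=a$, and that $x(t,a)\in\Omega$ for all $t\ge 0$. For a matrix $A$, let $A^{(k)}$ be its $k$th multiplicative compound (the matrix of all minors of order $k$, with rows and columns indexed by $k$-element subsets in lexicographic order), for $A\in\mathbb{R}^{n\times n}$ let $A^{[k]}:=\frac{d}{d\varepsilon}(I+\varepsilon A)^{(k)}|_{\varepsilon=0}\in\mathbb{R}^{r\times r}$ be its $k$th additive compound, and for $u^1,\dots,u^k\in\mathbb{R}^n$ let $u^1\wedge\dots\wedge u^k:=[u^1\ \cdots\ u^k]^{(k)}\in\mathbb{R}^r$. Let $S^k:=\{s\in\mathbb{R}^k: s_i\ge0,\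 s_1+\dots+s_k\le1\}$. For $a^1,\dots,a^{k+1}\in\Omega$ and $s\in S^k$ put $h(s):=\sum_{i=1}^k s_ia^i+(1-\sum_{i=1}^k s_i)a^{k+1}$ and $w^i(t,s):=\frac{\partial}{\partial s_i}x(t,h(s))$, the derivative being taken relative to $S^k$. The system is called $k$-order contractive with respect to a norm $|\cdot|$ on $\mathbb{R}^r$ if there is $\bar\eta>0$ such that, for all $a^1,\dots,a^{k+1}\in\Omega$, all $s\in S^k$ and all $t\ge0$, the map $s\mapsto x(t,h(s))$ is differentiable at $s$ relative to $S^k$ and $$|w^1(t,s)\wedge\dots\wedge w^k(t,s)|\le e^{-\bar\eta t}\,|w^1(0,s)\wedge\dots\wedge w^k(0,s)|.$$ Proposition. Suppose that the system is $k$-cooperative, i.e. for all $t\ge0$ and $x\in\Omega$ the matrix $J^{[k]}(t,x):=(J(t,x))^{[k]}$ is Metzler (all its off-diagonal entries are non-negative). If there exist $\eta>0$ and $v\in\mathbb{R}^r$ with $v_i>0$ for all $i$ such that $$v^TJ^{[k]}(t,x)\le-\eta\,1_r^T\quad\text{for all } t\ge0 \text{ and } x\in\Omega$$ (entrywise, where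 $1_r$ is the all-ones vector in $\mathbb{R}^r$), then the system is $k$-order contractive with respect to the scaled $L_1$ norm $|y|_V:=|Vy|_1$ on $\mathbb{R}^r$, where $V:=\operatorname{diag}(v_1,\dots,v_r)$. -/

import Mathlib

noncomputable section

namespace KContraction

/-- The index set `Q_{k,n}`: increasing sequences of `k` numbers from an `n`-element range,
i.e. the `k`-element subsets of `Fin n`. It has `n.choose k` elements. -/
abbrev Q (k n : ℕ) : Type := {s : Finset (Fin n) // s.card = k}

/-- The increasing enumeration of an element of `Q_{k,n}`. -/
def Q.seq {k n : ℕ} (κ : Q k n) : Fin k ↪o Fin n := κ.1.orderEmbOfFin κ.2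

theorem card_Q (k n : ℕ) : Fintype.card (Q k n) = n.choose k := by
  simp [Q]

/-- The `k`th multiplicative compound `A^{(k)}`: the matrix of all minors of order `k`. -/
def mulCompound {n m : ℕ} (k : ℕ) (A : Matrix (Fin n) (Fin m) ℝ) : Matrix (Q k n) (Q k m) ℝ :=
  Matrix.of fun α β => (A.submatrix α.seq β.seq).det

/-- The `k`th additive compound `A^{[k]} = d/dε (I + ε A)^{(k)}` at `ε = 0`, taken entrywise
(every entry of `(I + ε A)^{(k)}` is a polynomial in `ε`). -/
def addCompound {n : ℕ} (k : ℕ) (A : Matrix (Fin n) (Fin n) ℝ) : Matrix (Q k n) (Q k n) ℝ :=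
  Matrix.of fun α β => deriv (fun ε : ℝ => mulCompound k (1 + ε • A) α β) 0

/-- The only element of `Q_{k,k}`. -/
def Q.full (k : ℕ) : Q k k := ⟨Finset.univ, by simp⟩

/-- The wedge product `u^1 ∧ ⋯ ∧ u^k := [u^1 ⋯ u^k]^{(k)}`, a column indexed by `Q_{k,n}`. -/
def wedge {n k : ℕ} (u : Fin k → Fin n → ℝ) : Q k n → ℝ :=
  fun κ => mulCompound k (Matrix.of fun i j => u j i) κ (Q.full k)

/-- A square matrix is Metzler if all its off-diagonal entries are non-negative. -/
def IsMetzler {ι : Type*} (M : Matrix ι ι ℝ) : Prop :=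
  ∀ i j, i ≠ j → 0 ≤ M i j

/-- The Jacobian matrix `J(t,x) = ∂f/∂x (t,x)`. -/
def jacobian {n : ℕ} (f : ℝ → (Fin n → ℝ) → (Fin n → ℝ)) (t : ℝ) (x : Fin n → ℝ) :
    Matrix (Fin n) (Fin n) ℝ :=
  LinearMap.toMatrix' (fderiv ℝ (f t) x : (Fin n → ℝ) →ₗ[ℝ] (Fin n → ℝ))

/-- `f(t,x)` is continuously differentiable with respect to `x`, for `t ≥ 0`: the derivative
`∂f/∂x` exists and is continuous in `(t,x)`. -/
def IsC1InState {n : ℕ} (f : ℝ → (Fin n → ℝ) → (Fin n → ℝ)) : Prop :=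
  (∀ t, 0 ≤ t → Differentiable ℝ (f t)) ∧
    ContinuousOn (fun p : ℝ × (Fin n → ℝ) => fderiv ℝ (f p.1) p.2) (Set.Ici 0 ×ˢ Set.univ)

/-- `y` solves `y'(t) = f(t, y(t))` for all `t ≥ 0` (one-sided derivative at `t = 0`). -/
def IsSolution {n : ℕ} (f : ℝ → (Fin n → ℝ) → (Fin n → ℝ)) (y : ℝ → Fin n → ℝ) : Prop :=
  ∀ t, 0 ≤ t → HasDerivWithinAt y (f t (y t)) (Set.Ici 0) t

/-- For every initial condition `a ∈ Ω` the curve `t ↦ x t a` is the unique solution with value `a`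
at time `0`, and it remains in `Ω` for all `t ≥ 0`. -/
structure IsSolutionMap {n : ℕ} (f : ℝ → (Fin n → ℝ) → (Fin n → ℝ)) (Ω : Set (Fin n → ℝ))
    (x : ℝ → (Fin n → ℝ) → (Fin n → ℝ)) : Prop where
  initial : ∀ a ∈ Ω, x 0 a = a
  solution : ∀ a ∈ Ω, IsSolution f (fun t => x t a)
  mem : ∀ a ∈ Ω, ∀ t, 0 ≤ t → x t a ∈ Ω
  unique : ∀ a ∈ Ω, ∀ y : ℝ → Fin n → ℝ, IsSolution f y → y 0 = a → ∀ t, 0 ≤ t → y t = x t a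

/-- The system is `k`-cooperative on `Ω`: `J^{[k]}(t,x)` is Metzler for all `t ≥ 0`, `x ∈ Ω`. -/
def IsKCooperative {n : ℕ} (k : ℕ) (f : ℝ → (Fin n → ℝ) → (Fin n → ℝ))
    (Ω : Set (Fin n → ℝ)) : Prop :=
  ∀ t, 0 ≤ t → ∀ x ∈ Ω, IsMetzler (addCompound k (jacobian f t x))

/-- The unit simplex `S^k = {r ∈ ℝ^k | r_i ≥ 0, r_1 + ⋯ + r_k ≤ 1}`. -/
def unitSimplex (k : ℕ) : Set (Fin k → ℝ) :=
  {r | (∀ i, 0 ≤ r i) ∧ ∑ i, r i ≤ 1}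

/-- `h(r) = ∑_{i ≤ k} r_i a^i + (1 - ∑_{i ≤ k} r_i) a^{k+1}`. -/
def simplexPoint {n k : ℕ} (a : Fin (k + 1) → Fin n → ℝ) (r : Fin k → ℝ) : Fin n → ℝ :=
  ∑ i, r i • a i.castSucc + (1 - ∑ i, r i) • a (Fin.last k)

/-- `w^i(t,r) = ∂/∂r_i x(t,h(r))`. Since `x(t,h(r))` is a function on the simplex `S^k`, the
derivative is the one relative to `S^k`; at interior points it is the usual partial derivative. -/
def variation {n k : ℕ} (x : ℝ → (Fin n → ℝ) → (Fin n → ℝ)) (a : Fin (k + 1) → Fin n → ℝ)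
    (t : ℝ) (r : Fin k → ℝ) (i : Fin k) : Fin n → ℝ :=
  fderivWithin ℝ (fun s => x t (simplexPoint a s)) (unitSimplex k) r (Pi.single i 1)

/-- The system with solution map `x` on `Ω` is `k`-order contractive with respect to `N`: `N` is a
norm, and there is a rate `η > 0` such that for all `a^1, …, a^{k+1} ∈ Ω`, `r ∈ S^k` and `t ≥ 0`
the vectors `w^i(t,r)` exist and `|⋀ w^i(t,r)| ≤ exp(-η t) |⋀ w^i(0,r)|`. -/
def IsKOrderContractive {n : ℕ} (k : ℕ) (Ω : Set (Fin n → ℝ))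
    (x : ℝ → (Fin n → ℝ) → (Fin n → ℝ)) (N : Seminorm ℝ (Q k n → ℝ)) : Prop :=
  (∀ y, N y = 0 → y = 0) ∧
  ∃ η : ℝ, 0 < η ∧ ∀ a : Fin (k + 1) → Fin n → ℝ, (∀ i, a i ∈ Ω) →
    ∀ r ∈ unitSimplex k, ∀ t, 0 ≤ t →
      DifferentiableWithinAt ℝ (fun s => x t (simplexPoint a s)) (unitSimplex k) r ∧
      N (wedge (variation x a t r)) ≤ Real.exp (-η * t) * N (wedge (variation x a 0 r))

/-- The scaled `L_1` norm `|y|_V = |V y|_1` with `V = diag(v)`. -/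
def scaledL1 {ι : Type*} [Fintype ι] [DecidableEq ι] (v : ι → ℝ) : Seminorm ℝ (ι → ℝ) :=
  Seminorm.of (fun y => ∑ i, |(Matrix.diagonal v).mulVec y i|)
    (fun y z => by
      rw [← Finset.sum_add_distrib]
      refine Finset.sum_le_sum fun i _ => ?_
      rw [Matrix.mulVec_add]
      exact abs_add_le _ _)
    (fun c y => by
      simp [Matrix.mulVec_smul, abs_mul, Finset.mul_sum])

end KContraction

end

/-!
Along the trajectory `γ(t) = x(t, h(r))` the vectors `w^i(t, r)` solve the variational equation
`w' = J(t, γ(t)) w`, so their wedge product `y` solves `y' = J^{[k]}(t, γ(t)) y`. The matrix of this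
system is Metzler, and its weighted column sums satisfy `vᵀ J^{[k]} ≤ -η 1ᵀ ≤ -c vᵀ` for a suitable
`c > 0`. An Euler step `y ↦ (1 + h J^{[k]}) y` then has nonnegative coefficients for small `h > 0`
and shrinks `∑ v_κ |y_κ|` by the factor `1 - c h`; Grönwall's inequality turns this into the decay
rate `c` (`scaledL1_le_exp_mul`).

* The equation for the wedge product (`hasDerivWithinAt_wedge`) comes from the Cauchy–Binet formula
  `det_mul_eq_sum_Q`: the compound of `1 + ε A` acts on wedge products, and differentiating at
  `ε = 0` gives the additive compound.
* The derivative of `x(t, ·)` relative to `Ω` is the fundamental solution of the variational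
  equation (`hasFDerivWithinAt_solution`). The fundamental solution is the Peano–Baker series
  (`exists_fundamental_solution`). Since `f` need not be continuous in `t`, and trajectories need not
  stay in a bounded set, the estimates concern differences of solutions in a tube around `γ`.
* The simplex is convex with nonempty interior, so `fderivWithin` on it is the derivative given by
  the chain rule, at boundary points as well (`uniqueDiffOn_unitSimplex`).
-/

namespace KContraction

open Set Filter Topology

/-! ### Compounds and wedge products -/

/-- **Cauchy–Binet formula.** Expanding the rows of `A * B` multilinearly gives a sum over all maps
`Fin k → Fin n`; the injective ones are grouped by their range. -/
theorem det_mul_eq_sum_Q {k n : ℕ} (A : Matrix (Fin k) (Fin n) ℝ) (B : Matrix (Fin n) (Fin k) ℝ) :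
    (A * B).det = ∑ κ : Q k n, (A.submatrix id κ.seq).det * (B.submatrix κ.seq id).det := by
  have hrow : (A * B).det =
      ∑ g : Fin k → Fin n, (∏ i, A i (g i)) * (B.submatrix g id).det := by
    have h1 : A * B = fun i => ∑ j, A i j • B j := by
      ext i l
      simp [Matrix.mul_apply, Finset.sum_apply]
    change Matrix.detRowAlternating (A * B) = _
    rw [h1]
    erw [MultilinearMap.map_sum]
    refine Finset.sum_congr rfl fun g _ => ?_
    erw [MultilinearMap.map_smul_univ]
    rfl
  have hterm (κ : Q k n) : (A.submatrix id κ.seq).det * (B.submatrix κ.seq id).det =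
      ∑ σ : Equiv.Perm (Fin k),
        (∏ i, A i ((κ.seq ∘ σ) i)) * (B.submatrix (κ.seq ∘ σ) id).det := by
    have hB (σ : Equiv.Perm (Fin k)) : (B.submatrix (κ.seq ∘ σ) id).det =
        (Equiv.Perm.sign σ : ℝ) * (B.submatrix κ.seq id).det := by
      rw [← Matrix.det_permute]
      rfl
    rw [← Matrix.det_transpose, Matrix.det_apply', Finset.sum_mul]
    refine Finset.sum_congr rfl fun σ _ => ?_
    rw [hB]
    simp only [Matrix.transpose_apply, Matrix.submatrix_apply, id, Function.comp]
    ring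
  have himage (κ : Q k n) (σ : Equiv.Perm (Fin k)) :
      Set.range (κ.seq ∘ σ) = (κ.1 : Set (Fin n)) := by
    rw [σ.surjective.range_comp]
    exact Finset.range_orderEmbOfFin κ.1 κ.2
  rw [hrow, Finset.sum_congr rfl fun κ _ => hterm κ, ← Fintype.sum_prod_type']
  symm
  refine Finset.sum_of_injOn (fun p : Q k n × Equiv.Perm (Fin k) => p.1.seq ∘ p.2) ?_ ?_ ?_ ?_
  · rintro ⟨κ, σ⟩ - ⟨κ', σ'⟩ - h
    have hκ : κ = κ' := by
      refine Subtype.ext (Finset.coe_injective ?_)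
      rw [← himage κ σ, ← himage κ' σ']
      exact congrArg Set.range h
    subst hκ
    refine Prod.ext rfl (Equiv.ext fun i => κ.seq.injective (congrFun h i))
  · simp
  · intro g _ hg
    -- A non-injective `g` repeats a row of `B`; an injective one is `κ.seq ∘ σ` with `κ` its range.
    by_cases hinj : Function.Injective g
    · exfalso
      apply hg
      let κ : Q k n := ⟨Finset.univ.image g, by simp [Finset.card_image_of_injective _ hinj]⟩
      have hmem (i : Fin k) : ∃ j, κ.seq j = g i := by
        have : g i ∈ Set.range κ.seq := by
          rw [show Set.range κ.seq = (κ.1 : Set (Fin n)) from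
            Finset.range_orderEmbOfFin κ.1 κ.2]
          simp [κ]
        exact this
      choose s hs using hmem
      have hsinj : Function.Injective s := fun i j hij => hinj (by rw [← hs, ← hs, hij])
      refine ⟨(κ, Equiv.ofBijective s (Finite.injective_iff_bijective.mp hsinj)), by simp, ?_⟩
      funext i
      exact hs i
    · obtain ⟨i, j, hij, hne⟩ : ∃ i j, g i = g j ∧ i ≠ j := by
        simpa [Function.Injective] using hinj
      rw [Matrix.det_zero_of_row_eq hne (by ext l; simp [hij]), mul_zero]
  · intros; rfl

theorem Q.seq_full {k : ℕ} (i : Fin k) : (Q.full k).seq i = i := by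
  have h : RelEmbedding.refl (· ≤ ·) = (Q.full k).seq :=
    Finset.orderEmbOfFin_unique' (Q.full k).2 fun i => Finset.mem_univ i
  rw [← h]; rfl

/-- A coordinate of a wedge product is the minor with the rows `κ` and all the columns. -/
theorem wedge_apply {n k : ℕ} (u : Fin k → Fin n → ℝ) (κ : Q k n) :
    wedge u κ = (Matrix.of fun i j => u j (κ.seq i)).det := by
  simp only [wedge, mulCompound, Matrix.of_apply]
  congr 1
  ext i j
  simp [Q.seq_full]

/-- The Cauchy–Binet formula in terms of compounds: `A^{(k)}` carries `⋀ u` to `⋀ (A u)`. -/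
theorem wedge_mulVec {n k : ℕ} (A : Matrix (Fin n) (Fin n) ℝ) (u : Fin k → Fin n → ℝ) :
    wedge (fun j => A.mulVec (u j)) = (mulCompound k A).mulVec (wedge u) := by
  funext κ
  have h : (Matrix.of fun i j => (A.mulVec (u j)) (κ.seq i) : Matrix (Fin k) (Fin k) ℝ) =
      A.submatrix κ.seq id * Matrix.of fun i j => u j i := by
    ext i j
    simp [Matrix.mul_apply, Matrix.mulVec, dotProduct]
  rw [wedge_apply, h, det_mul_eq_sum_Q]
  refine Finset.sum_congr rfl fun β _ => ?_
  rw [wedge_apply]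
  rfl

theorem differentiable_det_of {E : Type*} [NormedAddCommGroup E] [NormedSpace ℝ E] {k : ℕ}
    {M : E → Matrix (Fin k) (Fin k) ℝ} (hM : ∀ i j, Differentiable ℝ fun e => M e i j) :
    Differentiable ℝ fun e => (M e).det := by
  simp only [Matrix.det_apply']
  fun_prop

theorem hasDerivAt_mulCompound {n k : ℕ} (A : Matrix (Fin n) (Fin n) ℝ) (α β : Q k n) :
    HasDerivAt (fun ε : ℝ => mulCompound k (1 + ε • A) α β) (addCompound k A α β) 0 := by
  refine DifferentiableAt.hasDerivAt (differentiable_det_of (fun i j => ?_)).differentiableAt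
  simp only [Matrix.submatrix_apply, Matrix.add_apply, Matrix.smul_apply]
  fun_prop

/-- If every `u j` moves with velocity `A (u j)`, then the wedge product of the `u j` moves with
velocity `A^{[k]} (⋀ u)`. The velocity of the wedge product depends only on the velocities of the
factors, so it can be computed along the curve `ε ↦ (1 + ε A) u`. -/
theorem hasDerivWithinAt_wedge {n k : ℕ} {A : Matrix (Fin n) (Fin n) ℝ}
    {u : ℝ → Fin k → Fin n → ℝ} {s : Set ℝ} {t : ℝ}
    (hu : ∀ j, HasDerivWithinAt (fun τ => u τ j) (A.mulVec (u t j)) s t) :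
    HasDerivWithinAt (fun τ => wedge (u τ)) ((addCompound k A).mulVec (wedge (u t))) s t := by
  rw [hasDerivWithinAt_pi]
  intro κ
  have hd : Differentiable ℝ fun w : Fin k → Fin n → ℝ => wedge w κ := by
    simp only [wedge_apply]
    refine differentiable_det_of fun i j => ?_
    simp only [Matrix.of_apply]
    fun_prop
  have hD := (hd (u t)).hasFDerivAt
  have h1 := hD.comp_hasDerivWithinAt t (hasDerivWithinAt_pi.mpr hu)
  have hcurve : HasDerivAt (fun ε : ℝ => fun j => (1 + ε • A).mulVec (u t j))
      (fun j => A.mulVec (u t j)) 0 := by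
    rw [hasDerivAt_pi]
    intro j
    simp only [Matrix.add_mulVec, Matrix.one_mulVec, Matrix.smul_mulVec]
    simpa using ((hasDerivAt_id (0 : ℝ)).smul_const (A.mulVec (u t j))).const_add (u t j)
  have h2 : HasDerivAt (fun ε : ℝ => wedge (fun j => (1 + ε • A).mulVec (u t j)) κ)
      (fderiv ℝ (fun w : Fin k → Fin n → ℝ => wedge w κ) (u t) fun j => A.mulVec (u t j)) 0 := by
    refine HasFDerivAt.comp_hasDerivAt (0 : ℝ) (l := fun w : Fin k → Fin n → ℝ => wedge w κ) ?_
      hcurve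
    simpa using hD
  have h3 : HasDerivAt (fun ε : ℝ => wedge (fun j => (1 + ε • A).mulVec (u t j)) κ)
      ((addCompound k A).mulVec (wedge (u t)) κ) 0 := by
    simp only [wedge_mulVec, Matrix.mulVec, dotProduct]
    exact HasDerivAt.fun_sum fun β _ => (hasDerivAt_mulCompound A κ β).mul_const _
  rw [← h2.unique h3]
  exact h1

/-! ### Contraction of linear Metzler systems in a weighted `L₁` norm -/

theorem scaledL1_apply {ι : Type*} [Fintype ι] [DecidableEq ι] {v : ι → ℝ} (hv : ∀ i, 0 < v i)
    (y : ι → ℝ) : scaledL1 v y = ∑ i, v i * |y i| := by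
  change ∑ i, |(Matrix.diagonal v).mulVec y i| = _
  simp [Matrix.mulVec_diagonal, abs_mul, abs_of_pos (hv _)]

theorem eq_zero_of_scaledL1_eq_zero {ι : Type*} [Fintype ι] [DecidableEq ι] {v : ι → ℝ}
    (hv : ∀ i, 0 < v i) {y : ι → ℝ} (h : scaledL1 v y = 0) : y = 0 := by
  rw [scaledL1_apply hv,
    Finset.sum_eq_zero_iff_of_nonneg fun i _ => mul_nonneg (hv i).le (abs_nonneg _)] at h
  funext i
  simpa [(hv i).ne'] using h i (Finset.mem_univ i)

/-- For a Metzler matrix `M` and a small step size `h`, the matrix `1 + h M` of the explicit Euler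
step for `y' = M y` has nonnegative entries. -/
theorem IsMetzler.eventually_nonneg {ι : Type*} [Finite ι] [DecidableEq ι] {M : Matrix ι ι ℝ}
    (hM : IsMetzler M) : ∀ᶠ h in 𝓝[>] (0 : ℝ), ∀ i j, 0 ≤ (1 + h • M) i j := by
  rw [eventually_all]; intro i
  rw [eventually_all]; intro j
  rcases eq_or_ne i j with rfl | hij
  · have h1 : Tendsto (fun h : ℝ => (1 + h • M) i i) (𝓝[>] 0) (𝓝 1) := by
      refine tendsto_nhdsWithin_of_tendsto_nhds ?_
      have : Continuous fun h : ℝ => (1 + h • M) i i := by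
        simp only [Matrix.add_apply, Matrix.smul_apply]; fun_prop
      simpa using this.tendsto 0
    exact (h1.eventually (lt_mem_nhds one_pos)).mono fun h hh => hh.le
  · filter_upwards [self_mem_nhdsWithin] with h hh
    simpa [hij] using mul_nonneg (le_of_lt hh) (hM i j hij)

/-- If the columns of the Metzler matrix `M` satisfy `vᵀ M ≤ -c vᵀ`, then an Euler step of `y' = M y`
contracts the scaled `L₁` norm by the factor `1 - c h`. -/
theorem IsMetzler.eventually_scaledL1_le {ι : Type*} [Fintype ι] [DecidableEq ι]
    {M : Matrix ι ι ℝ} (hM : IsMetzler M) {v : ι → ℝ} (hv : ∀ i, 0 < v i) {c : ℝ}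
    (hc : ∀ j, Matrix.vecMul v M j ≤ -c * v j) (y : ι → ℝ) :
    ∀ᶠ h in 𝓝[>] (0 : ℝ), scaledL1 v (y + h • M.mulVec y) ≤ (1 - c * h) * scaledL1 v y := by
  filter_upwards [hM.eventually_nonneg, self_mem_nhdsWithin] with h hpos hh
  have hy : y + h • M.mulVec y = (1 + h • M).mulVec y := by
    simp [Matrix.add_mulVec, Matrix.smul_mulVec]
  rw [hy, scaledL1_apply hv, scaledL1_apply hv]
  calc ∑ i, v i * |(1 + h • M).mulVec y i|
      ≤ ∑ i, v i * ∑ j, (1 + h • M) i j * |y j| := by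
        gcongr with i _
        · exact (hv i).le
        · refine (Finset.abs_sum_le_sum_abs _ _).trans_eq (Finset.sum_congr rfl fun j _ => ?_)
          rw [abs_mul, abs_of_nonneg (hpos i j)]
    _ = ∑ j, Matrix.vecMul v (1 + h • M) j * |y j| := by
        simp only [Finset.mul_sum, Matrix.vecMul, dotProduct, Finset.sum_mul]
        rw [Finset.sum_comm]
        simp only [mul_assoc]
    _ ≤ ∑ j, (1 - c * h) * (v j * |y j|) := by
        refine Finset.sum_le_sum fun j _ => ?_
        rw [← mul_assoc]
        refine mul_le_mul_of_nonneg_right ?_ (abs_nonneg _)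
        have := mul_le_mul_of_nonneg_left (hc j) (le_of_lt hh)
        simp only [Matrix.vecMul_add, Matrix.vecMul_one, Matrix.vecMul_smul, Pi.add_apply,
          Pi.smul_apply, smul_eq_mul]
        linarith
    _ = (1 - c * h) * ∑ j, v j * |y j| := by rw [Finset.mul_sum]

theorem continuous_scaledL1 {ι : Type*} [Fintype ι] [DecidableEq ι] {v : ι → ℝ}
    (hv : ∀ i, 0 < v i) : Continuous (scaledL1 v) := by
  have : (scaledL1 v : (ι → ℝ) → ℝ) = fun y => ∑ i, v i * |y i| :=
    funext fun y => scaledL1_apply hv y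
  rw [this]
  fun_prop

/-- A linear system with Metzler matrices `M t` such that `vᵀ M t ≤ -c vᵀ` contracts the scaled `L₁`
norm at the rate `c`. -/
theorem scaledL1_le_exp_mul {ι : Type*} [Fintype ι] [DecidableEq ι]
    {M : ℝ → Matrix ι ι ℝ} {v : ι → ℝ} (hv : ∀ i, 0 < v i) {c : ℝ}
    (hM : ∀ t, 0 ≤ t → IsMetzler (M t))
    (hc : ∀ t, 0 ≤ t → ∀ j, Matrix.vecMul v (M t) j ≤ -c * v j) {y : ℝ → ι → ℝ}
    (hy : ∀ t, 0 ≤ t → HasDerivWithinAt y ((M t).mulVec (y t)) (Ici 0) t) {t : ℝ} (ht : 0 ≤ t) :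
    scaledL1 v (y t) ≤ Real.exp (-c * t) * scaledL1 v (y 0) := by
  have hcont : ContinuousOn (fun τ => scaledL1 v (y τ)) (Icc 0 t) := by
    refine (continuous_scaledL1 hv).comp_continuousOn fun τ hτ => ?_
    exact (hy τ hτ.1).continuousWithinAt.mono Icc_subset_Ici_self
  have key := le_gronwallBound_of_liminf_deriv_right_le (f := fun τ => scaledL1 v (y τ))
    (f' := fun τ => -c * scaledL1 v (y τ)) (δ := scaledL1 v (y 0)) (K := -c) (ε := 0) hcont ?_
    le_rfl (fun τ _ => by simp) t ⟨ht, le_rfl⟩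
  · rw [gronwallBound_ε0, sub_zero] at key
    linarith
  intro τ hτ r hr
  refine Eventually.frequently ?_
  have hslope := (hasDerivWithinAt_iff_tendsto_slope' self_notMem_Ioi).mp
    ((hy τ hτ.1).mono (Ioi_subset_Ici hτ.1))
  have hzero : Tendsto (fun z => scaledL1 v (slope y τ z - (M τ).mulVec (y τ))) (𝓝[>] τ)
      (𝓝 0) := by
    have h0 := (continuous_scaledL1 hv).tendsto (0 : ι → ℝ)
    rw [map_zero] at h0
    refine h0.comp ?_
    simpa using hslope.sub_const ((M τ).mulVec (y τ))
  have hstep : Tendsto (fun z => z - τ) (𝓝[>] τ) (𝓝[>] 0) := by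
    refine tendsto_nhdsWithin_iff.mpr ⟨?_, ?_⟩
    · refine tendsto_nhdsWithin_of_tendsto_nhds ?_
      simpa using (continuous_sub_right τ).tendsto τ
    · filter_upwards [self_mem_nhdsWithin] with z hz using sub_pos.mpr (mem_Ioi.mp hz)
  filter_upwards [self_mem_nhdsWithin, hstep.eventually
    ((hM τ hτ.1).eventually_scaledL1_le hv (hc τ hτ.1) (y τ)),
    hzero.eventually (gt_mem_nhds (sub_pos.mpr hr))] with z hz hle hlt
  have hzτ : 0 < z - τ := sub_pos.mpr (mem_Ioi.mp hz)
  -- `y z` is an Euler step from `y τ`, up to an error that is `o(z - τ)`.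
  have hsplit : y z = (y τ + (z - τ) • (M τ).mulVec (y τ)) +
      (z - τ) • (slope y τ z - (M τ).mulVec (y τ)) := by
    rw [smul_sub, sub_smul_slope, vsub_eq_sub]
    abel
  have hstep_le : scaledL1 v (y z) ≤ (1 - c * (z - τ)) * scaledL1 v (y τ) +
      (z - τ) * scaledL1 v (slope y τ z - (M τ).mulVec (y τ)) := by
    conv_lhs => rw [hsplit]
    refine (map_add_le_add _ _ _).trans ?_
    rw [map_smul_eq_mul, Real.norm_of_nonneg hzτ.le]
    gcongr
  rw [inv_mul_lt_iff₀ hzτ]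
  nlinarith

/-! ### Fundamental solutions of linear systems -/

/-- The inductive step for bounding the terms of the Peano–Baker series: the bound
`C · K (C |t|)^m / m!` of the derivative is integrated. -/
theorem norm_le_pow_div_factorial_of_nonneg {E : Type*} [NormedAddCommGroup E] [NormedSpace ℝ E]
    {w w' : ℝ → E} (hw : ∀ t, HasDerivAt w (w' t) t) (hw0 : w 0 = 0) {K C R : ℝ} {m : ℕ}
    (hbound : ∀ t, |t| ≤ R → ‖w' t‖ ≤ C * (K * ((C * |t|) ^ m / m.factorial)))
    {t : ℝ} (ht0 : 0 ≤ t) (htR : t ≤ R) :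
    ‖w t‖ ≤ K * ((C * t) ^ (m + 1) / (m + 1).factorial) := by
  refine image_norm_le_of_norm_deriv_right_le_deriv_boundary (a := 0) (b := R)
    (f' := w') (B := fun t => K * ((C * t) ^ (m + 1) / (m + 1).factorial))
    (B' := fun t => C * (K * ((C * t) ^ m / m.factorial)))
    (fun s _ => (hw s).continuousAt.continuousWithinAt) (fun s _ => (hw s).hasDerivWithinAt)
    (by simp [hw0]) (fun s => ?_) (fun s hs => ?_) ⟨ht0, htR⟩
  · have h := ((((hasDerivAt_id s).const_mul C).fun_pow (m + 1)).div_const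
      ((m + 1).factorial : ℝ)).const_mul K
    refine h.congr_deriv ?_
    have h1 : (m.factorial : ℝ) ≠ 0 := by positivity
    have h2 : (m : ℝ) + 1 ≠ 0 := by positivity
    simp only [Nat.factorial_succ, id]
    push_cast
    field_simp
  · have := hbound s (by rw [abs_of_nonneg hs.1]; exact hs.2.le)
    rwa [abs_of_nonneg hs.1] at this

theorem norm_le_pow_div_factorial {E : Type*} [NormedAddCommGroup E] [NormedSpace ℝ E]
    {w w' : ℝ → E} (hw : ∀ t, HasDerivAt w (w' t) t) (hw0 : w 0 = 0) {K C R : ℝ} {m : ℕ}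
    (hbound : ∀ t, |t| ≤ R → ‖w' t‖ ≤ C * (K * ((C * |t|) ^ m / m.factorial)))
    {t : ℝ} (htR : |t| ≤ R) :
    ‖w t‖ ≤ K * ((C * |t|) ^ (m + 1) / (m + 1).factorial) := by
  rcases le_total 0 t with ht | ht
  · rw [abs_of_nonneg ht] at htR ⊢
    exact norm_le_pow_div_factorial_of_nonneg hw hw0 hbound ht htR
  · rw [abs_of_nonpos ht] at htR ⊢
    -- Reflecting time reduces the negative times to the positive ones.
    have h := norm_le_pow_div_factorial_of_nonneg (w := fun s => w (-s)) (w' := fun s => -w' (-s))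
      (fun s => by simpa [Function.comp_def] using (hw (-s)).scomp s (hasDerivAt_neg s))
      (by simpa using hw0)
      (K := K) (C := C) (m := m)
      (fun s hs => by simpa using hbound (-s) (by simpa using hs)) (neg_nonneg.mpr ht) htR
    simpa using h

/-- The terms of the Peano–Baker series: iterated integrals of `A`. -/
noncomputable def peanoBaker {𝔸 : Type*} [NormedRing 𝔸] [NormedAlgebra ℝ 𝔸] (A : ℝ → 𝔸) :
    ℕ → ℝ → 𝔸
  | 0, _ => 1
  | m + 1, t => ∫ s in (0 : ℝ)..t, A s * peanoBaker A m s

section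

variable {𝔸 : Type*} [NormedRing 𝔸] [NormedAlgebra ℝ 𝔸] {A : ℝ → 𝔸}

theorem continuous_peanoBaker (hA : Continuous A) (m : ℕ) : Continuous (peanoBaker A m) := by
  induction m with
  | zero => exact continuous_const
  | succ m ih =>
    exact intervalIntegral.continuous_primitive
      (fun a b => (hA.mul ih).intervalIntegrable a b) 0

variable [CompleteSpace 𝔸]

theorem hasDerivAt_peanoBaker (hA : Continuous A) (m : ℕ) (t : ℝ) :
    HasDerivAt (peanoBaker A (m + 1)) (A t * peanoBaker A m t) t :=
  (hA.mul (continuous_peanoBaker hA m)).integral_hasStrictDerivAt 0 t |>.hasDerivAt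

theorem norm_peanoBaker_le (hA : Continuous A) {C R : ℝ} (hC : ∀ t, |t| ≤ R → ‖A t‖ ≤ C) (m : ℕ)
    {t : ℝ} (ht : |t| ≤ R) :
    ‖peanoBaker A m t‖ ≤ ‖(1 : 𝔸)‖ * ((C * |t|) ^ m / m.factorial) := by
  induction m generalizing t with
  | zero => simp [peanoBaker]
  | succ m ih =>
    refine norm_le_pow_div_factorial (hasDerivAt_peanoBaker hA m) (by simp [peanoBaker])
      (fun s hs => ?_) ht
    exact (norm_mul_le _ _).trans
      (mul_le_mul (hC s hs) (ih hs) (norm_nonneg _) ((norm_nonneg _).trans (hC s hs)))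

/-- A linear system with continuous coefficients has a fundamental solution on the whole line, the
sum of the Peano–Baker series. The factorial bounds on its terms allow differentiating term by
term on every bounded interval. -/
theorem exists_fundamental_solution (hA : Continuous A) :
    ∃ Φ : ℝ → 𝔸, Φ 0 = 1 ∧ ∀ t, HasDerivAt Φ (A t * Φ t) t := by
  refine ⟨fun t => 1 + ∑' m, peanoBaker A (m + 1) t, by simp [peanoBaker], fun t => ?_⟩
  set R : ℝ := |t| + 1
  obtain ⟨C, hC⟩ : ∃ C, ∀ s ∈ Icc (-R) R, ‖A s‖ ≤ C :=
    isCompact_Icc.exists_bound_of_continuousOn hA.continuousOn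
  have hC' : ∀ s, |s| ≤ R → ‖A s‖ ≤ C := fun s hs => hC s (abs_le.mp hs)
  have hR : 0 ≤ R := by positivity
  have hC0 : 0 ≤ C := (norm_nonneg _).trans (hC' 0 (by simpa using hR))
  have hle {m : ℕ} {s : ℝ} (hs : |s| ≤ R) :
      ‖peanoBaker A m s‖ ≤ ‖(1 : 𝔸)‖ * ((C * R) ^ m / m.factorial) := by
    refine (norm_peanoBaker_le hA hC' m hs).trans ?_
    gcongr
  have hsum : Summable fun m : ℕ => ‖(1 : 𝔸)‖ * ((C * R) ^ m / m.factorial) :=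
    (Real.summable_pow_div_factorial (C * R)).mul_left _
  have htR : t ∈ Ioo (-R) R := abs_lt.mp (lt_add_one _)
  have hconv : Summable fun m => peanoBaker A m t :=
    Summable.of_norm_bounded hsum fun m => hle (abs_lt.mpr htR).le
  have h := hasDerivAt_tsum_of_isPreconnected (g := fun m => peanoBaker A (m + 1))
    (g' := fun m s => A s * peanoBaker A m s) (hsum.mul_left C) isOpen_Ioo isPreconnected_Ioo
    (fun m s _ => hasDerivAt_peanoBaker hA m s) (fun m s hs => ?_) htR
    ((summable_nat_add_iff 1).mpr hconv) htR
  · refine (h.const_add 1).congr_deriv ?_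
    rw [hconv.tsum_mul_left, hconv.tsum_eq_zero_add]
    rfl
  · have hsR : |s| ≤ R := (abs_lt.mpr hs).le
    exact (norm_mul_le _ _).trans (mul_le_mul (hC' s hsR) (hle hsR) (norm_nonneg _) hC0)

end

/-! ### Differentiability with respect to the initial value -/

section

variable {E : Type*} [NormedAddCommGroup E] [NormedSpace ℝ E] {f : ℝ → E → E}

/-- First-order expansion of `f t` along a curve `γ`, uniformly for `t` in a compact interval. -/
theorem exists_forall_norm_sub_fderiv_le (hf : ∀ t, 0 ≤ t → Differentiable ℝ (f t))
    (hf' : ContinuousOn (fun p : ℝ × E => fderiv ℝ (f p.1) p.2) (Ici 0 ×ˢ univ))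
    {γ : ℝ → E} (hγ : ContinuousOn γ (Ici 0)) (T : ℝ) {ε : ℝ} (hε : 0 < ε) :
    ∃ δ > 0, ∀ t ∈ Icc 0 T, ∀ y, ‖y - γ t‖ ≤ δ →
      ‖f t y - f t (γ t) - fderiv ℝ (f t) (γ t) (y - γ t)‖ ≤ ε * ‖y - γ t‖ := by
  -- Negative times are projected to `0`, which makes the derivative along the curve continuous on
  -- the whole space.
  have hmax : Continuous fun t : ℝ => max t 0 := by fun_prop
  have hγ' : Continuous fun t : ℝ => γ (max t 0) :=
    hγ.comp_continuous hmax fun t => le_max_right t 0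
  have hG : Continuous fun p : ℝ × E => fderiv ℝ (f (max p.1 0)) (γ (max p.1 0) + p.2) :=
    hf'.comp_continuous
      ((hmax.comp continuous_fst).prodMk ((hγ'.comp continuous_fst).add continuous_snd))
      fun p => ⟨le_max_right p.1 0, mem_univ _⟩
  have hG0 : Continuous fun p : ℝ × E =>
      ‖fderiv ℝ (f (max p.1 0)) (γ (max p.1 0) + p.2) -
        fderiv ℝ (f (max p.1 0)) (γ (max p.1 0) + 0)‖ :=
    (hG.sub (hG.comp (continuous_fst.prodMk continuous_const))).norm
  have hev : ∀ᶠ z in 𝓝 (0 : E), ∀ t ∈ Icc 0 T,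
      ‖fderiv ℝ (f (max t 0)) (γ (max t 0) + z) -
        fderiv ℝ (f (max t 0)) (γ (max t 0) + 0)‖ < ε := by
    refine isCompact_Icc.eventually_forall_of_forall_eventually fun t _ => ?_
    have h := (hG0.comp continuous_swap).tendsto ((0 : E), t)
    exact h.eventually (gt_mem_nhds (by simpa using hε))
  obtain ⟨δ, hδ, hball⟩ := Metric.eventually_nhds_iff_ball.mp hev
  refine ⟨δ / 2, half_pos hδ, fun t ht y hy => ?_⟩
  refine (convex_closedBall (γ t) (δ / 2)).norm_image_sub_le_of_norm_fderiv_le'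
    (fun z _ => hf t ht.1 z) (fun z hz => ?_)
    (Metric.mem_closedBall_self (half_pos hδ).le) (mem_closedBall_iff_norm.mpr hy)
  have h := hball (z - γ t) (by
    rw [mem_ball_zero_iff]
    exact (mem_closedBall_iff_norm.mp hz).trans_lt (half_lt_self hδ)) t ht
  rw [max_eq_left ht.1, add_sub_cancel, add_zero] at h
  exact h.le

/-- Differentiability of the solution with respect to the initial value: its derivative is the
fundamental solution of the variational equation. The vector field need not be continuous in time,
since only differences of solutions are estimated. -/
theorem hasFDerivWithinAt_solution (hf : ∀ t, 0 ≤ t → Differentiable ℝ (f t))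
    (hf' : ContinuousOn (fun p : ℝ × E => fderiv ℝ (f p.1) p.2) (Ici 0 ×ˢ univ))
    {Ω : Set E} {x : ℝ → E → E} (hx0 : ∀ a ∈ Ω, x 0 a = a)
    (hx : ∀ a ∈ Ω, ∀ t, 0 ≤ t → HasDerivWithinAt (fun τ => x τ a) (f t (x t a)) (Ici 0) t)
    {a : E} (ha : a ∈ Ω) {Φ : ℝ → E →L[ℝ] E} (hΦ0 : Φ 0 = 1)
    (hΦ : ∀ t, 0 ≤ t → HasDerivWithinAt Φ (fderiv ℝ (f t) (x t a) * Φ t) (Ici 0) t)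
    {T : ℝ} (hT : 0 ≤ T) : HasFDerivWithinAt (x T) (Φ T) Ω a := by
  have hγ : ContinuousOn (fun τ => x τ a) (Ici 0) := fun t ht =>
    (hx a ha t ht).continuousWithinAt
  obtain ⟨C, hC1, hC⟩ : ∃ C, 1 ≤ C ∧ ∀ t ∈ Icc 0 T, ‖fderiv ℝ (f t) (x t a)‖ ≤ C := by
    have hcont : ContinuousOn (fun t => fderiv ℝ (f t) (x t a)) (Icc 0 T) :=
      hf'.comp (continuousOn_id.prodMk (hγ.mono Icc_subset_Ici_self))
        fun t ht => ⟨ht.1, mem_univ _⟩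
    obtain ⟨C, hC⟩ := isCompact_Icc.exists_bound_of_continuousOn hcont
    exact ⟨max C 1, le_max_right _ _, fun t ht => (hC t ht).trans (le_max_left _ _)⟩
  set L : ℝ := Real.exp ((C + 2) * T)
  have hL : 0 < L := Real.exp_pos _
  rw [hasFDerivWithinAt_iff_isLittleO, Asymptotics.isLittleO_iff]
  intro c hc
  set ε : ℝ := min 1 (c / (L * Real.exp (C * T)))
  have hε : 0 < ε := lt_min one_pos (by positivity)
  obtain ⟨δ, hδ, hexp⟩ := exists_forall_norm_sub_fderiv_le hf hf' hγ T hε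
  filter_upwards [self_mem_nhdsWithin,
    mem_nhdsWithin_of_mem_nhds (Metric.ball_mem_nhds a (div_pos hδ hL))] with b hb hba
  -- The fence below has to be strictly positive, which excludes `b = a`.
  rcases eq_or_ne b a with rfl | hne
  · simp
  have hpos : 0 < ‖b - a‖ := norm_pos_iff.mpr (sub_ne_zero.mpr hne)
  have hsmall : ‖b - a‖ * L ≤ δ := by
    rw [mem_ball_iff_norm, lt_div_iff₀ hL] at hba
    exact hba.le
  have hsub (t : ℝ) (ht : 0 ≤ t) : HasDerivWithinAt (fun τ => x τ b - x τ a)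
      (f t (x t b) - f t (x t a)) (Ici 0) t := (hx b hb t ht).sub (hx a ha t ht)
  have hexpT {t : ℝ} (ht : t ≤ T) : ‖b - a‖ * Real.exp ((C + 2) * t) ≤ ‖b - a‖ * L := by
    have : 0 ≤ C + 2 := by linarith
    simp only [L]
    gcongr
  -- The expansion is valid only `δ`-close to the trajectory of `a`. The fencing theorem needs the
  -- derivative bound only where the distance touches the fence, and the fence stays below `δ`.
  have hgrow : ∀ t ∈ Icc 0 T, ‖x t b - x t a‖ ≤ ‖b - a‖ * Real.exp ((C + 2) * t) := by
    intro t ht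
    refine image_norm_le_of_norm_deriv_right_lt_deriv_boundary (f := fun τ => x τ b - x τ a)
      (f' := fun τ => f τ (x τ b) - f τ (x τ a))
      (B := fun τ => ‖b - a‖ * Real.exp ((C + 2) * τ))
      (B' := fun τ => ‖b - a‖ * (Real.exp ((C + 2) * τ) * (C + 2)))
      (fun τ hτ => (hsub τ hτ.1).continuousWithinAt.mono Icc_subset_Ici_self)
      (fun τ hτ => (hsub τ hτ.1).mono (Ici_subset_Ici.mpr hτ.1))
      (by simp [hx0 a ha, hx0 b hb]) (fun τ => ?_) (fun τ hτ heq => ?_) ht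
    · simpa using (((hasDerivAt_id τ).const_mul (C + 2)).exp).const_mul ‖b - a‖
    · have hτ' : τ ∈ Icc 0 T := ⟨hτ.1, hτ.2.le⟩
      have h1 := hexp τ hτ' (x τ b) (heq.trans_le ((hexpT hτ.2.le).trans hsmall))
      have h2 := (fderiv ℝ (f τ) (x τ a)).le_of_opNorm_le (hC τ hτ') (x τ b - x τ a)
      have h3 : ‖f τ (x τ b) - f τ (x τ a)‖ ≤ ε * ‖x τ b - x τ a‖ + C * ‖x τ b - x τ a‖ := by
        refine (norm_le_norm_sub_add _ (fderiv ℝ (f τ) (x τ a) (x τ b - x τ a))).trans ?_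
        exact add_le_add h1 h2
      have h4 : 0 < ‖b - a‖ * Real.exp ((C + 2) * τ) := by positivity
      rw [heq] at h3
      have h5 : ε ≤ 1 := min_le_left _ _
      nlinarith
  have herr (t : ℝ) (ht : 0 ≤ t) : HasDerivWithinAt (fun τ => x τ b - x τ a - Φ τ (b - a))
      (f t (x t b) - f t (x t a) - (fderiv ℝ (f t) (x t a) * Φ t) (b - a)) (Ici 0) t :=
    (hsub t ht).sub
      ((ContinuousLinearMap.apply ℝ E (b - a)).hasFDerivAt.comp_hasDerivWithinAt t (hΦ t ht))
  have hgron := norm_le_gronwallBound_of_norm_deriv_right_le (δ := 0) (K := C)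
    (ε := ε * (‖b - a‖ * L)) (a := 0) (b := T)
    (fun τ hτ => (herr τ hτ.1).continuousWithinAt.mono Icc_subset_Ici_self)
    (fun τ hτ => (herr τ hτ.1).mono (Ici_subset_Ici.mpr hτ.1))
    (by simp [hx0 a ha, hx0 b hb, hΦ0]) (fun τ hτ => ?_) T ⟨hT, le_rfl⟩
  · refine hgron.trans ?_
    rw [gronwallBound_of_K_ne_0 (by positivity)]
    simp only [sub_zero, zero_mul, zero_add]
    have h1 : ε * (L * Real.exp (C * T)) ≤ c :=
      (le_div_iff₀ (by positivity)).mp (min_le_right _ _)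
    calc ε * (‖b - a‖ * L) / C * (Real.exp (C * T) - 1)
        ≤ ε * (‖b - a‖ * L) * Real.exp (C * T) := by
          gcongr
          · exact sub_nonneg.mpr (Real.one_le_exp (by positivity))
          · exact div_le_self (by positivity) hC1
          · linarith
      _ = ε * (L * Real.exp (C * T)) * ‖b - a‖ := by ring
      _ ≤ c * ‖b - a‖ := by gcongr
  · have hτ' : τ ∈ Icc 0 T := ⟨hτ.1, hτ.2.le⟩
    have hz := (hgrow τ hτ').trans (hexpT hτ.2.le)
    have h1 := hexp τ hτ' (x τ b) (hz.trans hsmall)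
    have h2 := (fderiv ℝ (f τ) (x τ a)).le_of_opNorm_le (hC τ hτ') (x τ b - x τ a - Φ τ (b - a))
    calc ‖f τ (x τ b) - f τ (x τ a) - (fderiv ℝ (f τ) (x τ a) * Φ τ) (b - a)‖
        = ‖fderiv ℝ (f τ) (x τ a) (x τ b - x τ a - Φ τ (b - a)) +
            (f τ (x τ b) - f τ (x τ a) - fderiv ℝ (f τ) (x τ a) (x τ b - x τ a))‖ := by
          rw [map_sub _ (x τ b - x τ a), mul_apply_eq_comp]
          congr 1
          abel
      _ ≤ C * ‖x τ b - x τ a - Φ τ (b - a)‖ + ε * (‖b - a‖ * L) := by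
          refine (norm_add_le _ _).trans (add_le_add h2 (h1.trans ?_))
          gcongr

end

/-! ### The solution map on a simplex of initial values -/

/-- The linear part of the affine map `simplexPoint a`. -/
def simplexDirection {n k : ℕ} (a : Fin (k + 1) → Fin n → ℝ) : (Fin k → ℝ) →L[ℝ] (Fin n → ℝ) :=
  ∑ i, (ContinuousLinearMap.proj i : (Fin k → ℝ) →L[ℝ] ℝ).smulRight (a i.castSucc - a (Fin.last k))

theorem simplexDirection_single {n k : ℕ} (a : Fin (k + 1) → Fin n → ℝ) (i : Fin k) :
    simplexDirection a (Pi.single i 1) = a i.castSucc - a (Fin.last k) := by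
  simp only [simplexDirection, sum_apply, ContinuousLinearMap.smulRight_apply,
    ContinuousLinearMap.proj_apply]
  rw [Finset.sum_eq_single i (fun j _ hj => by simp [hj]) (by simp)]
  simp

theorem hasFDerivAt_simplexPoint {n k : ℕ} (a : Fin (k + 1) → Fin n → ℝ) (r : Fin k → ℝ) :
    HasFDerivAt (simplexPoint a) (simplexDirection a) r := by
  have h : simplexPoint a = fun s => simplexDirection a s + a (Fin.last k) := by
    funext s
    simp only [simplexPoint, simplexDirection, sum_apply,
      ContinuousLinearMap.smulRight_apply, ContinuousLinearMap.proj_apply, smul_sub,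
      Finset.sum_sub_distrib, sub_smul, Finset.sum_smul, one_smul]
    abel
  rw [h]
  exact (simplexDirection a).hasFDerivAt.add_const _

theorem simplexPoint_mem {n k : ℕ} {Ω : Set (Fin n → ℝ)} (hΩ : Convex ℝ Ω)
    {a : Fin (k + 1) → Fin n → ℝ} (ha : ∀ i, a i ∈ Ω) {r : Fin k → ℝ} (hr : r ∈ unitSimplex k) :
    simplexPoint a r ∈ Ω := by
  have h := hΩ.sum_mem (t := Finset.univ) (w := Fin.snoc (α := fun _ => ℝ) r (1 - ∑ i, r i))
    (z := a) (fun i _ => ?_) ?_ fun i _ => ha i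
  · simpa [Fin.sum_univ_castSucc, simplexPoint] using h
  · refine Fin.lastCases ?_ (fun j => ?_) i
    · simpa using hr.2
    · simpa using hr.1 j
  · simp [Fin.sum_univ_castSucc]

theorem convex_unitSimplex (k : ℕ) : Convex ℝ (unitSimplex k) := by
  intro r hr s hs p q hp hq hpq
  refine ⟨fun i => ?_, ?_⟩
  · exact add_nonneg (mul_nonneg hp (hr.1 i)) (mul_nonneg hq (hs.1 i))
  · simp only [Pi.add_apply, Pi.smul_apply, smul_eq_mul, Finset.sum_add_distrib, ← Finset.mul_sum]
    calc p * ∑ i, r i + q * ∑ i, s i ≤ p * 1 + q * 1 := by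
          gcongr
          exacts [hr.2, hs.2]
      _ = 1 := by rw [mul_one, mul_one, hpq]

/-- Derivatives relative to the simplex are unique: it is convex with nonempty interior. -/
theorem uniqueDiffOn_unitSimplex (k : ℕ) : UniqueDiffOn ℝ (unitSimplex k) := by
  refine uniqueDiffOn_convex (convex_unitSimplex k) ?_
  have hopen : IsOpen {r : Fin k → ℝ | (∀ i, 0 < r i) ∧ ∑ i, r i < 1} := by
    have h1 : IsOpen {r : Fin k → ℝ | ∀ i, 0 < r i} := by
      simp only [ofPred_forall]
      exact isOpen_iInter_of_finite fun i => isOpen_lt continuous_const (continuous_apply i)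
    exact h1.inter (isOpen_lt
      (continuous_finsetSum Finset.univ fun i _ => continuous_apply i) continuous_const)
  have hsub : {r : Fin k → ℝ | (∀ i, 0 < r i) ∧ ∑ i, r i < 1} ⊆ unitSimplex k :=
    fun r hr => ⟨fun i => (hr.1 i).le, hr.2.le⟩
  refine ⟨fun _ => 1 / ((k : ℝ) + 1), interior_maximal hsub hopen ⟨fun i => by positivity, ?_⟩⟩
  rw [Finset.sum_const, Finset.card_univ, Fintype.card_fin, nsmul_eq_mul, mul_one_div,
    div_lt_one (by positivity)]
  exact lt_add_one _

/-- Along each trajectory starting in `Ω` there is a fundamental solution of the variational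
equation, and it is the derivative of the solution map relative to `Ω`. -/
theorem IsSolutionMap.exists_variational {n : ℕ} {f : ℝ → (Fin n → ℝ) → (Fin n → ℝ)}
    (hf : IsC1InState f) {Ω : Set (Fin n → ℝ)} {x : ℝ → (Fin n → ℝ) → (Fin n → ℝ)}
    (hx : IsSolutionMap f Ω x) {p : Fin n → ℝ} (hp : p ∈ Ω) :
    ∃ Φ : ℝ → (Fin n → ℝ) →L[ℝ] (Fin n → ℝ),
      (∀ t, 0 ≤ t → HasDerivWithinAt Φ (fderiv ℝ (f t) (x t p) * Φ t) (Ici 0) t) ∧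
      ∀ t, 0 ≤ t → HasFDerivWithinAt (x t) (Φ t) Ω p := by
  have hmax : Continuous fun t : ℝ => max t 0 := by fun_prop
  have hγ : ContinuousOn (fun t => x t p) (Ici 0) := fun t ht =>
    (hx.solution p hp t ht).continuousWithinAt
  have hA : Continuous fun t : ℝ => fderiv ℝ (f (max t 0)) (x (max t 0) p) :=
    hf.2.comp_continuous
      (hmax.prodMk (hγ.comp_continuous hmax fun t => le_max_right t 0))
      fun t => ⟨le_max_right t 0, mem_univ _⟩
  obtain ⟨Φ, hΦ0, hΦ⟩ := exists_fundamental_solution hA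
  have hΦ' (t : ℝ) (ht : 0 ≤ t) :
      HasDerivWithinAt Φ (fderiv ℝ (f t) (x t p) * Φ t) (Ici 0) t := by
    simpa only [max_eq_left ht] using (hΦ t).hasDerivWithinAt (s := Ici 0)
  exact ⟨Φ, hΦ', fun t ht =>
    hasFDerivWithinAt_solution hf.1 hf.2 hx.initial hx.solution hp hΦ0 hΦ' ht⟩

theorem jacobian_mulVec {n : ℕ} (f : ℝ → (Fin n → ℝ) → (Fin n → ℝ)) (t : ℝ) (z y : Fin n → ℝ) :
    (jacobian f t z).mulVec y = fderiv ℝ (f t) z y := by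
  rw [jacobian, LinearMap.toMatrix'_mulVec]
  rfl

end KContraction

theorem mainTheorem6
    {n k : ℕ} (hk1 : 1 ≤ k) (hkn : k ≤ n)
    (f : ℝ → (Fin n → ℝ) → (Fin n → ℝ)) (hf : KContraction.IsC1InState f)
    (Ω : Set (Fin n → ℝ)) (hclosed : IsClosed Ω) (hconvex : Convex ℝ Ω)
    (x : ℝ → (Fin n → ℝ) → (Fin n → ℝ)) (hx : KContraction.IsSolutionMap f Ω x)
    (hcoop : KContraction.IsKCooperative k f Ω)
    (v : KContraction.Q k n → ℝ) (hv : ∀ κ, 0 < v κ)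
    (η : ℝ) (hη : 0 < η)
    (hineq : ∀ t, 0 ≤ t → ∀ z ∈ Ω, ∀ κ,
      Matrix.vecMul v (KContraction.addCompound k (KContraction.jacobian f t z)) κ ≤ -η) :
    KContraction.IsKOrderContractive k Ω x (KContraction.scaledL1 v) := by
  open KContraction in
  -- The bound `vᵀ M ≤ -η 1ᵀ` yields `vᵀ M ≤ -c vᵀ` for `c = η / S` with any `S > 0` above all
  -- entries of `v`; here `S = 1 + ∑ v`.
  have hS : 0 < 1 + ∑ κ, v κ := by
    have := Finset.sum_nonneg fun κ (_ : κ ∈ Finset.univ) => (hv κ).le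
    linarith
  refine ⟨fun y => eq_zero_of_scaledL1_eq_zero hv, η / (1 + ∑ κ, v κ), div_pos hη hS,
    fun a ha r hr t ht => ?_⟩
  have hp := simplexPoint_mem hconvex ha hr
  obtain ⟨Φ, hΦ, hxΦ⟩ := hx.exists_variational hf hp
  have hder (τ : ℝ) (hτ : 0 ≤ τ) :
      HasFDerivWithinAt (fun s => x τ (simplexPoint a s)) ((Φ τ).comp (simplexDirection a))
        (unitSimplex k) r :=
    (hxΦ τ hτ).comp r (hasFDerivAt_simplexPoint a r).hasFDerivWithinAt
      fun s hs => simplexPoint_mem hconvex ha hs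
  have hvar (τ : ℝ) (hτ : 0 ≤ τ) :
      variation x a τ r = fun i => Φ τ (a i.castSucc - a (Fin.last k)) := by
    funext i
    rw [variation, (hder τ hτ).fderivWithin (uniqueDiffOn_unitSimplex k r hr),
      ContinuousLinearMap.comp_apply, simplexDirection_single]
  refine ⟨(hder t ht).differentiableWithinAt, ?_⟩
  rw [hvar t ht, hvar 0 le_rfl]
  refine scaledL1_le_exp_mul
    (M := fun τ => addCompound k (jacobian f τ (x τ (simplexPoint a r))))
    (y := fun τ => wedge fun i => Φ τ (a i.castSucc - a (Fin.last k))) hv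
    (fun τ hτ => hcoop τ hτ _ (hx.mem _ hp τ hτ)) (fun τ hτ κ => ?_) (fun τ hτ => ?_) ht
  · refine (hineq τ hτ _ (hx.mem _ hp τ hτ) κ).trans ?_
    rw [neg_mul, neg_le_neg_iff, div_mul_eq_mul_div, div_le_iff₀ hS]
    have := Finset.single_le_sum (fun β _ => (hv β).le) (Finset.mem_univ κ)
    gcongr
    linarith
  · refine hasDerivWithinAt_wedge fun i => ?_
    rw [jacobian_mulVec]
    exact (ContinuousLinearMap.apply ℝ (Fin n → ℝ) _).hasFDerivAt.comp_hasDerivWithinAt τ (hΦ τ hτ)
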